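/- **Conventions.** Formulas are built from countably many variables by $\bot,\neg,\lor,\Diamond$ (with $\Box=\neg\Diamond\neg$). A *logic* is a normal modal logic. A *rule* is a pair $\Gamma/\Delta$ of finite sets of formulas. A *rule system* is a normal modal multi-conclusion rule system, i.e. a set of rules containing $\varphi/\varphi$, $\;\varphi,\varphi\to\psi/\psi$, $\;\varphi/\Box\varphi$, and $/\varphi$ for each theorem $\varphi$ of the least normal modal logic $\mathsf K$, and closed under weakening, cut and substitution. A *modal algebra* is a Boolean algebra with an operation $\Diamond$ satisfying $\Diamond 0=0$ and $\Diamond(a\lor b)=\Diamond a\lor\Diamond b$; it validates $\Gamma/\Delta$ if every valuation sending all of $\Gamma$ to $1$ sends some member of $\Delta$ to $1$. A *modal space* is a Stone space $X$ with a relation $R$ such that each $R[x]$ is closed and $R^{-1}[U]$ is clopen for each clopen $U$; valuations on it take clopen values, and a rule $\Gamma/\Delta$ is valid in it if every valuation making all of $\Gamma$ true at every point makes some member of $\Delta$ true at every point. A modal algebra or space validates a logic or a rule system if it validates all its members. It is *topo-rooted* if the set of points $x$ for which $\{y: x R^k y \text{ for some } k\ge 0\}$ is dense has non-empty interior. A logic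 (resp. rule system) has the *finite model property* if every formula (resp. rule) outside it is refuted in a finite modal algebra that validates it. **Definable filtration.** Let $\Theta\subseteq\Theta'$ be finite subformula-closed sets of formulas and $V$ a valuation on a modal algebra $A$. A *definable filtration of $(A,V)$ for $\Theta$ through $\Theta'$* is a modal algebra $A'=(B,\Diamond')$, where $B$ is the Boolean subalgebra of $A$ generated by $V[\Theta']$, with the valuation $V'(p)=V(p)$ for variables $p\in\Theta'$ and $V'(p)=0$ for variables $p\notin\Theta'$, such that $\Diamond a\le\Diamond' a$ for all $a\in B$, with equality whenever $a=V(\varphi)$ for some $\Diamond\varphi\in\Theta$. A class $\mathcal C$ of modal algebras admits definable filtration if for every finite subformula-closed $\Theta$ there is a finite subformula-closed $\Theta'\supseteq\Theta$ such that for all $A\in\mathcal C$ and all valuations $V$ on $A$ there is a definable filtration of $(A,V)$ for $\Theta$ through $\Theta'$ whose algebra lies in $\mathcal C$. A logic or rule system admits definable filtration if the class of all modal algebras validating it does. **Subdivision Construction.** The *rank* of a point is the supremum in $\omega+1$ of the numbers of points of finite paths starting at it (so dead ends have rank $1$). Let $(X,R)$ be a modal space, $(F,Q)$ a finite modal space,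 $\mathcal D\subseteq\mathcal P(F)$, and $f:X\twoheadrightarrow_{\mathcal D}F$ a continuous surjective map such that $xRy$ implies $f(x)Qf(y)$ and, for all $D\in\mathcal D$, $Q[f(x)]\cap D\ne\emptyset$ implies $f(R[x])\cap D\neq\emptyset$. Put $F_1=F$, $Q_1=Q$, $f_1=f$. Given $(F_n,Q_n)$ and $f_n:X\to F_n$, let $C$ be the set of points of $F_n$ of rank $\le n$ and $V$ the set of those of rank $n+1$. For $v\in V$ and $s\subseteq C$ let $U^v_s$ be the set of $x\in f_n^{-1}(v)$ such that, for all $c\in C$, $x\in R^{-1}[f_n^{-1}(c)]$ iff $c\in s$. Let $W$ consist of fresh points $w^v_s$, one for each $v\in V$, $s\subseteq C$ with $U^v_s\neq\emptyset$, and let $F_{n+1}=(F_n\setminus V)\cup W$, where, for $p,q\notin W$: $pQ_{n+1}q$ iff $pQ_nq$; $pQ_{n+1}w^v_s$ iff $pQ_nv$; $w^v_sQ_{n+1}q$ iff $q\in s$; and no point of $W$ sees a point of $W$. Let $f_{n+1}(x)=w^v_s$ if $x\in U^v_s$, and $f_{n+1}(x)=f_n(x)$ if $f_n(x)\notin V$.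 The output is $F'=F_N$, where $N$ is the largest finite rank of a point of $F$ ($F'=F$ if there is none). For rule systems $\mathcal S\subseteq\mathcal S'$, the construction *preserves $\mathcal S'$ over $\mathcal S$* if for all such $X,F,\mathcal D,f$ with $X\models\mathcal S'$ and $F\models\mathcal S$ we have $F'\models\mathcal S'$. For logics $L\subseteq L'$, it *preserves $L'$ over $L$* if for all such $X,F,\mathcal D,f$ with $X$ topo-rooted, $X\models L'$ and $F\models L$ we have $F'\models L'$. **Theorem.** 1. Let $\mathcal S$ be a rule system that admits definable filtration, and $\mathcal S'\supseteq\mathcal S$ a rule system such that the Subdivision Construction preserves $\mathcal S'$ over $\mathcal S$. Then $\mathcal S'$ has the finite model property. 2. Let $L$ be a logic that admits definable filtration, and $L'\supseteq L$ a logic such that the Subdivision Construction preserves $L'$ over $L$. Then $L'$ has the finite model property. -/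

import Mathlib

namespace ModalLogic

/-! ### Syntax -/

/-- Modal formulas over countably many propositional variables. -/
inductive Formula : Type where
  | var : ℕ → Formula
  | bot : Formula
  | neg : Formula → Formula
  | or : Formula → Formula → Formula
  | dia : Formula → Formula
  deriving DecidableEq

namespace Formula

def and (φ ψ : Formula) : Formula := neg (or (neg φ) (neg ψ))
def imp (φ ψ : Formula) : Formula := or (neg φ) ψ
def iff (φ ψ : Formula) : Formula := and (imp φ ψ) (imp ψ φ)
def box (φ : Formula) : Formula := neg (dia (neg φ))

/-- Uniform substitution. -/
def subst (s : ℕ → Formula) : Formula → Formula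
  | var n => s n
  | bot => bot
  | neg φ => neg (subst s φ)
  | or φ ψ => or (subst s φ) (subst s ψ)
  | dia φ => dia (subst s φ)

/-- Classical truth value, where variables and formulas `◇φ` are treated as atoms. -/
def propEval (v : Formula → Prop) : Formula → Prop
  | var n => v (var n)
  | bot => False
  | neg φ => ¬ propEval v φ
  | or φ ψ => propEval v φ ∨ propEval v ψ
  | dia φ => v (dia φ)

/-- Substitution instances of classical propositional tautologies. -/
def Tautology (φ : Formula) : Prop := ∀ v, propEval v φ

/-- The immediate subformulas of a formula. -/
def children : Formula → Set Formula
  | var _ => ∅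
  | bot => ∅
  | neg φ => {φ}
  | or φ ψ => {φ, ψ}
  | dia φ => {φ}

end Formula

/-- A set of formulas is subformula-closed. -/
def SubformulaClosed (Θ : Set Formula) : Prop :=
  ∀ φ ∈ Θ, ∀ ψ ∈ φ.children, ψ ∈ Θ

/-- Normal modal logics. -/
structure IsLogic (L : Set Formula) : Prop where
  taut : ∀ φ : Formula, φ.Tautology → φ ∈ L
  axiomK : ∀ φ ψ : Formula, ((φ.imp ψ).box.imp (φ.box.imp ψ.box)) ∈ L
  dual : ∀ φ : Formula, (φ.dia.iff φ.neg.box.neg) ∈ L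
  mp : ∀ φ ψ : Formula, φ.imp ψ ∈ L → φ ∈ L → ψ ∈ L
  nec : ∀ φ : Formula, φ ∈ L → φ.box ∈ L
  subst : ∀ (s : ℕ → Formula) (φ : Formula), φ ∈ L → φ.subst s ∈ L

/-- The least normal modal logic. -/
def logicK : Set Formula := ⋂₀ {L | IsLogic L}

/-- Multi-conclusion modal rules `Γ / Δ`, with `Γ` and `Δ` finite sets of formulas. -/
structure Rule : Type where
  prem : Finset Formula
  concl : Finset Formula

/-- Normal modal multi-conclusion rule systems. -/
structure IsRuleSystem (S : Set Rule) : Prop where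
  refl : ∀ φ : Formula, ⟨{φ}, {φ}⟩ ∈ S
  mp : ∀ φ ψ : Formula, ⟨{φ, φ.imp ψ}, {ψ}⟩ ∈ S
  nec : ∀ φ : Formula, ⟨{φ}, {φ.box}⟩ ∈ S
  thm : ∀ φ ∈ logicK, ⟨∅, {φ}⟩ ∈ S
  weakening : ∀ Γ Δ Γ' Δ' : Finset Formula,
    ⟨Γ, Δ⟩ ∈ S → ⟨Γ ∪ Γ', Δ ∪ Δ'⟩ ∈ S
  cut : ∀ (Γ Δ : Finset Formula) (φ : Formula),
    ⟨Γ, insert φ Δ⟩ ∈ S → ⟨insert φ Γ, Δ⟩ ∈ S → ⟨Γ, Δ⟩ ∈ S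
  subst : ∀ (s : ℕ → Formula) (Γ Δ : Finset Formula),
    ⟨Γ, Δ⟩ ∈ S → ⟨Γ.image (Formula.subst s), Δ.image (Formula.subst s)⟩ ∈ S

/-! ### Modal algebras -/

/-- Modal algebras. The one-element algebra is allowed. -/
structure ModalAlgebra : Type 1 where
  carrier : Type
  [boolean : BooleanAlgebra carrier]
  dia : carrier → carrier
  dia_bot : dia ⊥ = ⊥
  dia_sup : ∀ a b, dia (a ⊔ b) = dia a ⊔ dia b

instance : CoeSort ModalAlgebra Type := ⟨ModalAlgebra.carrier⟩

instance (A : ModalAlgebra) : BooleanAlgebra A := A.boolean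

namespace ModalAlgebra

/-- The value of a formula under the valuation `V`. -/
def eval (A : ModalAlgebra) (V : ℕ → A) : Formula → A
  | .var n => V n
  | .bot => ⊥
  | .neg φ => (A.eval V φ)ᶜ
  | .or φ ψ => A.eval V φ ⊔ A.eval V ψ
  | .dia φ => A.dia (A.eval V φ)

def ValidFormula (A : ModalAlgebra) (φ : Formula) : Prop :=
  ∀ V : ℕ → A, A.eval V φ = ⊤

def ValidRule (A : ModalAlgebra) (ρ : Rule) : Prop :=
  ∀ V : ℕ → A, (∀ γ ∈ ρ.prem, A.eval V γ = ⊤) → ∃ δ ∈ ρ.concl, A.eval V δ = ⊤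

/-- `A` is an `L`-algebra. -/
def ModelsLogic (A : ModalAlgebra) (L : Set Formula) : Prop := ∀ φ ∈ L, A.ValidFormula φ

/-- `A` is an `S`-algebra. -/
def ModelsSystem (A : ModalAlgebra) (S : Set Rule) : Prop := ∀ ρ ∈ S, A.ValidRule ρ

/-- A Boolean homomorphism is stable. -/
def StableHom {A B : ModalAlgebra} (h : BoundedLatticeHom A B) : Prop :=
  ∀ a : A, B.dia (h a) ≤ h (A.dia a)

/-- The closed domain condition for a set `D` of elements. -/
def CDC {A B : ModalAlgebra} (h : BoundedLatticeHom A B) (D : Set A) : Prop :=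
  ∀ a ∈ D, h (A.dia a) = B.dia (h a)

end ModalAlgebra

/-- A logic has the finite model property. -/
def LogicFMP (L : Set Formula) : Prop :=
  ∀ φ, φ ∉ L → ∃ A : ModalAlgebra, Finite A ∧ A.ModelsLogic L ∧ ¬ A.ValidFormula φ

/-- A rule system has the finite model property. -/
def SystemFMP (S : Set Rule) : Prop :=
  ∀ ρ, ρ ∉ S → ∃ A : ModalAlgebra, Finite A ∧ A.ModelsSystem S ∧ ¬ A.ValidRule ρ

/-! ### Definable filtration -/

/-- The Boolean subalgebra of `A` generated by the values of the formulas in `Θ'`. -/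
def filtrationCarrier (A : ModalAlgebra) (V : ℕ → A) (Θ' : Set Formula) : BooleanSubalgebra A :=
  BooleanSubalgebra.closure (A.eval V '' Θ')

/-- A modal algebra structure on a Boolean subalgebra of `A`, with an operator of its own. -/
def subalgebraWith {A : ModalAlgebra} (B : BooleanSubalgebra A) (d : B → B)
    (hbot : d ⊥ = ⊥) (hsup : ∀ a b, d (a ⊔ b) = d a ⊔ d b) : ModalAlgebra where
  carrier := B
  dia := d
  dia_bot := hbot
  dia_sup := hsup

/-- Definable filtrations `(A', V')` of `(A, V)` for `Θ` through `Θ'`. -/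
structure DefinableFiltration (A : ModalAlgebra) (V : ℕ → A) (Θ Θ' : Set Formula) where
  dia : filtrationCarrier A V Θ' → filtrationCarrier A V Θ'
  dia_bot : dia ⊥ = ⊥
  dia_sup : ∀ a b, dia (a ⊔ b) = dia a ⊔ dia b
  val : ℕ → filtrationCarrier A V Θ'
  val_mem : ∀ p, Formula.var p ∈ Θ' → (val p : A) = V p
  val_notMem : ∀ p, Formula.var p ∉ Θ' → val p = ⊥
  stable : ModalAlgebra.StableHom (A := subalgebraWith _ dia dia_bot dia_sup) (B := A)
    (filtrationCarrier A V Θ').subtype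
  cdc : ModalAlgebra.CDC (A := subalgebraWith _ dia dia_bot dia_sup) (B := A)
    (filtrationCarrier A V Θ').subtype
    {a : filtrationCarrier A V Θ' | ∃ φ : Formula, φ.dia ∈ Θ ∧ (a : A) = A.eval V φ}

/-- The modal algebra `A'` of a definable filtration. -/
def DefinableFiltration.algebra {A : ModalAlgebra} {V : ℕ → A} {Θ Θ' : Set Formula}
    (E : DefinableFiltration A V Θ Θ') : ModalAlgebra :=
  subalgebraWith _ E.dia E.dia_bot E.dia_sup

/-- A class of modal algebras admits definable filtration. -/
def ClassAdmitsFiltration (C : Set ModalAlgebra) : Prop :=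
  ∀ Θ : Set Formula, Θ.Finite → SubformulaClosed Θ →
    ∃ Θ' : Set Formula, Θ'.Finite ∧ SubformulaClosed Θ' ∧ Θ ⊆ Θ' ∧
      ∀ A ∈ C, ∀ V : ℕ → A, ∃ E : DefinableFiltration A V Θ Θ', E.algebra ∈ C

def LogicAdmitsFiltration (L : Set Formula) : Prop :=
  ClassAdmitsFiltration {A | A.ModelsLogic L}

def SystemAdmitsFiltration (S : Set Rule) : Prop :=
  ClassAdmitsFiltration {A | A.ModelsSystem S}

/-! ### Modal spaces -/

/-- Modal spaces: a Stone space with a binary relation `R` such that every `R[x]` is closed and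
`R⁻¹[U]` is clopen for every clopen `U`. -/
structure ModalSpace : Type 1 where
  carrier : Type
  [top : TopologicalSpace carrier]
  [compact : CompactSpace carrier]
  [t2 : T2Space carrier]
  [totallyDisconnected : TotallyDisconnectedSpace carrier]
  rel : carrier → carrier → Prop
  isClosed_image : ∀ x, IsClosed {y | rel x y}
  isClopen_preimage : ∀ U : Set carrier, IsClopen U → IsClopen {x | ∃ y ∈ U, rel x y}

instance : CoeSort ModalSpace Type := ⟨ModalSpace.carrier⟩

instance (X : ModalSpace) : TopologicalSpace X := X.top
instance (X : ModalSpace) : CompactSpace X := X.compact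
instance (X : ModalSpace) : T2Space X := X.t2
instance (X : ModalSpace) : TotallyDisconnectedSpace X := X.totallyDisconnected

namespace ModalSpace

/-- Satisfaction of a formula at a point, under a valuation `V`. -/
def Sat (X : ModalSpace) (V : ℕ → Set X) : X → Formula → Prop
  | x, .var n => x ∈ V n
  | _, .bot => False
  | x, .neg φ => ¬ X.Sat V x φ
  | x, .or φ ψ => X.Sat V x φ ∨ X.Sat V x ψ
  | x, .dia φ => ∃ y, X.rel x y ∧ X.Sat V y φ

def ValidFormula (X : ModalSpace) (φ : Formula) : Prop :=
  ∀ V : ℕ → Set X, (∀ n, IsClopen (V n)) → ∀ x, X.Sat V x φ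

def ValidRule (X : ModalSpace) (ρ : Rule) : Prop :=
  ∀ V : ℕ → Set X, (∀ n, IsClopen (V n)) →
    (∀ γ ∈ ρ.prem, ∀ x, X.Sat V x γ) → ∃ δ ∈ ρ.concl, ∀ x, X.Sat V x δ

def ModelsLogic (X : ModalSpace) (L : Set Formula) : Prop := ∀ φ ∈ L, X.ValidFormula φ

def ModelsSystem (X : ModalSpace) (S : Set Rule) : Prop := ∀ ρ ∈ S, X.ValidRule ρ

/-- The closure of the set of points reachable from `x` in finitely many steps is everything. -/
def IsTopoRoot (X : ModalSpace) (x : X) : Prop :=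
  closure {y : X | Relation.ReflTransGen X.rel x y} = Set.univ

def TopoRooted (X : ModalSpace) : Prop := (interior {x : X | X.IsTopoRoot x}).Nonempty

/-- A continuous map preserving the relation. -/
def StableMap {X Y : ModalSpace} (f : X → Y) : Prop :=
  Continuous f ∧ ∀ x y, X.rel x y → Y.rel (f x) (f y)

/-- The closed domain condition for a family `𝒟` of subsets. -/
def CDC {X Y : ModalSpace} (f : X → Y) (𝒟 : Set (Set Y)) : Prop :=
  ∀ D ∈ 𝒟, ∀ x, (∃ q ∈ D, Y.rel (f x) q) → ∃ y, X.rel x y ∧ f y ∈ D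

/-- `f : X ↠_𝒟 Y`. -/
def StableOnto {X Y : ModalSpace} (𝒟 : Set (Set Y)) (f : X → Y) : Prop :=
  StableMap f ∧ Function.Surjective f ∧ CDC f 𝒟

/-- There is a path with `n` edges (hence with `n + 1` points) starting at `x`. -/
def HasPath (X : ModalSpace) : ℕ → X → Prop
  | 0, _ => True
  | n + 1, x => ∃ y, X.rel x y ∧ X.HasPath n y

/-- The rank of `x`: the supremum of the numbers of points of paths starting at `x`. -/
noncomputable def rank (X : ModalSpace) (x : X) : ℕ∞ :=
  ⨆ (n : ℕ) (_ : X.HasPath n x), ((n + 1 : ℕ) : ℕ∞)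

/-- A finite Kripke frame as a modal space, with the discrete topology. -/
def ofFinite (F : Type) [Finite F] (Q : F → F → Prop) : ModalSpace :=
  letI : TopologicalSpace F := ⊥
  haveI : DiscreteTopology F := ⟨rfl⟩
  { carrier := F
    rel := Q
    isClosed_image := fun _ => isClosed_discrete _
    isClopen_preimage := fun _ _ => isClopen_discrete _ }

end ModalSpace

/-! ### The Subdivision Construction -/

/-- The data `(F_n, f_n, g_n)` maintained by the Subdivision Construction for a map `X → F`:
a finite modal space `F_n` with maps `f_n : X → F_n` and `g_n : F_n → F`. -/
structure Stage (X F : ModalSpace) : Type 1 where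
  space : ModalSpace
  [finite : Finite space]
  map : X → space
  toBase : space → F

namespace Stage

instance {X F : ModalSpace} (T : Stage X F) : Finite T.space := T.finite

variable {X F : ModalSpace} (T : Stage X F) (n : ℕ)

/-- The points of rank at most `n`. -/
def Low : Type := {c : T.space // T.space.rank c ≤ n}

/-- The set of those points `c` of rank at most `n` with `x ∈ R⁻¹[f_n⁻¹(c)]`. -/
def profile (x : X) : Set (T.Low n) := {c | ∃ y, X.rel x y ∧ T.map y = c.1}

/-- The piece `U^v_s` of `f_n⁻¹(v)`. -/
def piece (v : T.space) (s : Set (T.Low n)) : Set X := {x | T.map x = v ∧ T.profile n x = s}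

/-- The points other than those of rank `n + 1`. -/
def Old : Type := {p : T.space // T.space.rank p ≠ (n + 1 : ℕ)}

/-- The fresh points `w^v_s`, where `v` has rank `n + 1` and `U^v_s` is non-empty. -/
def New : Type :=
  Σ v : {v : T.space // T.space.rank v = (n + 1 : ℕ)},
    {s : Set (T.Low n) // (T.piece n v.1 s).Nonempty}

instance : Finite (T.Low n) := Subtype.finite
instance : Finite (T.Old n) := Subtype.finite
instance : Finite (T.New n) := by unfold New; infer_instance

/-- The accessibility relation of the refined frame. -/
def stepRel : T.Old n ⊕ T.New n → T.Old n ⊕ T.New n → Prop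
  | .inl p, .inl q => T.space.rel p.1 q.1
  | .inl p, .inr w => T.space.rel p.1 w.1.1
  | .inr w, .inl q => ∃ c ∈ w.2.1, c.1 = q.1
  | .inr _, .inr _ => False

open Classical in
/-- The refined map from `X`. -/
noncomputable def stepMap (x : X) : T.Old n ⊕ T.New n :=
  if h : T.space.rank (T.map x) = (n + 1 : ℕ) then
    .inr ⟨⟨T.map x, h⟩, ⟨T.profile n x, ⟨x, rfl, rfl⟩⟩⟩
  else .inl ⟨T.map x, h⟩

/-- The map from the refined frame to the previous one. -/
def stepBack : T.Old n ⊕ T.New n → T.space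
  | .inl p => p.1
  | .inr w => w.1.1

/-- One step of the construction: the points of rank `n + 1` are subdivided. -/
noncomputable def step : Stage X F where
  space := ModalSpace.ofFinite (T.Old n ⊕ T.New n) (T.stepRel n)
  finite := inferInstanceAs (Finite (T.Old n ⊕ T.New n))
  map := T.stepMap n
  toBase := fun p => T.toBase (T.stepBack n p)

end Stage

/-- The stages of the construction; `stage f k` is `(F_{k+1}, f_{k+1}, g_{k+1})`, so that
`stage f 0` is `(F, f, id)`, and passing from `F_{k+1}` to `F_{k+2}` subdivides the points of
rank `k + 2`. -/
noncomputable def stage {X F : ModalSpace} [Finite F] (f : X → F) : ℕ → Stage X F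
  | 0 => { space := F, map := f, toBase := id }
  | k + 1 => (stage f k).step (k + 1)

/-- The largest finite rank of a point of `F` (and `0` if there is none). -/
noncomputable def maxFiniteRank (F : ModalSpace) : ℕ := sSup {m : ℕ | ∃ p : F, F.rank p = m}

/-- The result `(F', f', g) = (F_N, f_N, g_N)` of the Subdivision Construction applied to `f`,
with `N` the largest finite rank of a point of `F`; it is `(F_1, f_1, g_1)` if there is none. -/
noncomputable def subdivision {X F : ModalSpace} [Finite F] (f : X → F) : Stage X F :=
  stage f (maxFiniteRank F - 1)

/-- The Subdivision Construction preserves the rule system `S'` over `S`. -/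
def PreservesSystem (S S' : Set Rule) : Prop :=
  ∀ (X F : ModalSpace) [Finite F] (𝒟 : Set (Set F)) (f : X → F), ModalSpace.StableOnto 𝒟 f →
    X.ModelsSystem S' → F.ModelsSystem S → (subdivision f).space.ModelsSystem S'

/-- The Subdivision Construction preserves the logic `L'` over `L`. -/
def PreservesLogic (L L' : Set Formula) : Prop :=
  ∀ (X F : ModalSpace) [Finite F] (𝒟 : Set (Set F)) (f : X → F), ModalSpace.StableOnto 𝒟 f →
    X.TopoRooted → X.ModelsLogic L' → F.ModelsLogic L → (subdivision f).space.ModelsLogic L'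

end ModalLogic

/-! Suppose a rule or formula lies outside the larger system. A maximality argument yields a theory
`T`, not necessarily closed under substitution, that refutes it; the Lindenbaum algebra of `T` still
validates the larger system, because valuations there are substitutions and the system is closed
under these. It also validates the smaller system, so it has a definable filtration for the relevant
subformulas that validates the smaller system. Dually this is a stable surjection `f` from the dual
space `X` of the Lindenbaum algebra onto a finite space `F`, with the closed domain condition for
the values of those `φ` with `◇φ ∈ Θ`. By hypothesis, the subdivision `F'` of `F` validates the
larger system.

It remains to see that `F'` still refutes the rule or formula. Every stage of the construction
factors `f` as `X → F_n → F`, with both maps relation-preserving and the first one onto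
(`subdivision_factors`). This alone gives agreement of `X` and `F_n` on `Θ`
(`Stage.Factors.sat_iff`): successors in `X` are pushed forward to `F_n`, while a successor in `F_n`
is pushed down to `F` and lifted back to `X` by the closed domain condition.

For rule systems, `T` is the positive half of a maximal consistent pair of sets of formulas, and
maximality makes it closed under all multi-conclusion rules. For logics, `T` is maximal among
theories containing `L'` and omitting `φ`; maximality makes each point of the dual space that
refutes `φ` a topo-root, and these points form a non-empty open set. -/

namespace ModalLogic

/-! ### Duality between modal algebras and modal spaces -/

namespace ModalAlgebra

theorem dia_mono (A : ModalAlgebra) {a b : A} (h : a ≤ b) : A.dia a ≤ A.dia b := by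
  have := A.dia_sup a b
  rw [sup_eq_right.2 h] at this
  exact sup_eq_right.1 this.symm

/-- Boolean homomorphisms to the two-element algebra, that is, characteristic functions of
ultrafilters. -/
def IsPoint (A : ModalAlgebra) (x : A → Bool) : Prop :=
  x ⊤ = true ∧ (∀ a b, x (a ⊓ b) = (x a && x b)) ∧ ∀ a, x aᶜ = !x a

/-- The points of the dual space of a modal algebra. -/
def Point (A : ModalAlgebra) : Type := {x : A → Bool // A.IsPoint x}

instance (A : ModalAlgebra) : TopologicalSpace A.Point :=
  inferInstanceAs (TopologicalSpace (Subtype _))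

namespace Point

variable {A : ModalAlgebra}

instance : Membership A A.Point := ⟨fun x a => x.1 a = true⟩

theorem mem_def {x : A.Point} {a : A} : a ∈ x ↔ x.1 a = true := Iff.rfl

theorem top_mem (x : A.Point) : (⊤ : A) ∈ x := x.2.1

theorem inf_mem_iff (x : A.Point) {a b : A} : a ⊓ b ∈ x ↔ a ∈ x ∧ b ∈ x := by
  simp only [mem_def, x.2.2.1, Bool.and_eq_true]

theorem compl_mem_iff (x : A.Point) {a : A} : aᶜ ∈ x ↔ a ∉ x := by
  simp [mem_def, x.2.2.2]

theorem sup_mem_iff (x : A.Point) {a b : A} : a ⊔ b ∈ x ↔ a ∈ x ∨ b ∈ x := by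
  have := x.inf_mem_iff (a := aᶜ) (b := bᶜ)
  rw [← compl_sup, compl_mem_iff, compl_mem_iff, compl_mem_iff] at this
  tauto

theorem bot_notMem (x : A.Point) : (⊥ : A) ∉ x := by
  rw [← x.compl_mem_iff, compl_bot]; exact x.top_mem

theorem mem_of_le {x : A.Point} {a b : A} (h : a ≤ b) (ha : a ∈ x) : b ∈ x := by
  rw [← sup_eq_right.2 h, x.sup_mem_iff]; exact Or.inl ha

@[ext] theorem ext {x y : A.Point} (h : ∀ a, a ∈ x ↔ a ∈ y) : x = y :=
  Subtype.ext (funext fun a => Bool.eq_iff_iff.2 (h a))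

/-- Prime separation: a filter and an ideal that are disjoint are separated by a point. -/
theorem exists_separating {F I : Set A} (hF : Order.IsPFilter F) (hI : Order.IsIdeal I)
    (h : Disjoint F I) : ∃ x : A.Point, (∀ a ∈ F, a ∈ x) ∧ ∀ a ∈ I, a ∉ x := by
  classical
  obtain ⟨J, hJ, hIJ, hFJ⟩ := DistribLattice.prime_ideal_of_disjoint_filter_ideal
    (F := hF.toPFilter) (I := hI.toIdeal) h
  have hc : ∀ a, aᶜ ∉ J ↔ a ∈ J := fun a => by
    constructor
    · intro h; exact (hJ.mem_or_compl_mem).resolve_right h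
    · intro h h'
      refine hJ.toIsProper.top_notMem ?_
      rw [← sup_compl_eq_top (x := a)]; exact Order.Ideal.sup_mem h h'
  refine ⟨⟨fun a => decide (a ∉ J), ?_, ?_, ?_⟩, ?_, ?_⟩
  · simpa using hJ.toIsProper.top_notMem
  · intro a b
    rw [Bool.eq_iff_iff]
    simp only [decide_eq_true_eq, Bool.and_eq_true]
    constructor
    · intro h
      exact ⟨fun h' => h (J.lower inf_le_left h'), fun h' => h (J.lower inf_le_right h')⟩
    · rintro ⟨h1, h2⟩ h
      exact (hJ.mem_or_mem h).elim h1 h2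
  · intro a
    rw [Bool.eq_iff_iff]
    simp [hc a]
  · intro a ha
    exact decide_eq_true fun h' =>
      Set.disjoint_left.1 hFJ (show a ∈ (hF.toPFilter : Set A) from ha) h'
  · intro a ha
    exact fun h' => of_decide_eq_true h' (hIJ ha)

theorem isPFilter_Ici (a : A) : Order.IsPFilter (Set.Ici a) :=
  (Order.PFilter.principal a).isPFilter

theorem isIdeal_Iic (a : A) : Order.IsIdeal (Set.Iic a) :=
  (Order.Ideal.principal a).isIdeal

theorem exists_mem_notMem {a b : A} (h : ¬ a ≤ b) : ∃ x : A.Point, a ∈ x ∧ b ∉ x := by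
  obtain ⟨x, h1, h2⟩ := exists_separating (isPFilter_Ici a) (isIdeal_Iic b)
    (Set.disjoint_left.2 fun c hc hc' => h (le_trans hc hc'))
  exact ⟨x, h1 a le_rfl, h2 b le_rfl⟩

theorem eq_top_iff_forall_mem {a : A} : a = ⊤ ↔ ∀ x : A.Point, a ∈ x := by
  constructor
  · rintro rfl x; exact x.top_mem
  · intro h
    by_contra hne
    obtain ⟨x, -, hx⟩ := exists_mem_notMem (a := ⊤) (b := a) (fun h' => hne (top_le_iff.1 h'))
    exact hx (h x)

/-- The accessibility relation of the dual space. -/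
def Rel (x y : A.Point) : Prop := ∀ a ∈ y, A.dia a ∈ x

/-- The elements `b` with `◇b ∉ x` form an ideal, by additivity of `◇`. If `◇a ∈ x`, this ideal
misses the principal filter of `a`, and a separating point is the required successor. -/
theorem dia_mem_iff (x : A.Point) {a : A} : A.dia a ∈ x ↔ ∃ y, x.Rel y ∧ a ∈ y := by
  constructor
  · intro h
    have hI : Order.IsIdeal {b : A | A.dia b ∉ x} :=
      ⟨fun b c hcb hb hc => hb (mem_of_le (A.dia_mono hcb) hc),
        ⟨⊥, by simpa [A.dia_bot] using x.bot_notMem⟩,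
        fun b hb c hc => ⟨b ⊔ c, by
          simp only [Set.mem_ofPred_eq, A.dia_sup, sup_mem_iff] at *; tauto,
          le_sup_left, le_sup_right⟩⟩
    obtain ⟨y, h1, h2⟩ := exists_separating (isPFilter_Ici a) hI
      (Set.disjoint_left.2 fun c hc hc' => hc' (mem_of_le (A.dia_mono hc) h))
    refine ⟨y, fun b hb => ?_, h1 a le_rfl⟩
    by_contra hn
    exact h2 b hn hb
  · rintro ⟨y, hxy, hy⟩; exact hxy a hy

theorem continuous_apply (a : A) : Continuous fun x : A.Point => x.1 a :=
  (_root_.continuous_apply a).comp continuous_subtype_val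

theorem isClopen_mem (a : A) : IsClopen {x : A.Point | a ∈ x} :=
  (isClopen_discrete {true}).preimage (continuous_apply a)

/-- Each defining equation involves finitely many coordinates, so the points form a closed subset of
the Cantor cube; compactness follows from Tychonoff. -/
theorem isClosed_isPoint : IsClosed {x : A → Bool | A.IsPoint x} := by
  have h : ∀ a, Continuous fun x : A → Bool => x a := fun a => _root_.continuous_apply a
  have e : {x : A → Bool | A.IsPoint x} = {x | x ⊤ = true} ∩
      ((⋂ a, ⋂ b, {x | x (a ⊓ b) = (x a && x b)}) ∩ ⋂ a, {x | x aᶜ = !x a}) := by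
    ext x; simp [IsPoint]
  rw [e]
  refine (isClosed_eq (h ⊤) continuous_const).inter (IsClosed.inter ?_ ?_)
  · exact isClosed_iInter fun a => isClosed_iInter fun b =>
      isClosed_eq (h _) ((continuous_of_discreteTopology (f := fun p : Bool × Bool => p.1 && p.2)).comp
        ((h a).prodMk (h b)))
  · exact isClosed_iInter fun a =>
      isClosed_eq (h _) ((continuous_of_discreteTopology (f := Bool.not)).comp (h a))

instance : CompactSpace A.Point := isCompact_iff_compactSpace.1 isClosed_isPoint.isCompact
instance : T2Space A.Point := inferInstanceAs (T2Space (Subtype _))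
instance : TotallyDisconnectedSpace A.Point :=
  inferInstanceAs (TotallyDisconnectedSpace (Subtype _))

theorem inf_finset_mem_iff {ι : Type*} (s : Finset ι) (g : ι → A) (x : A.Point) :
    s.inf g ∈ x ↔ ∀ i ∈ s, g i ∈ x := by
  classical
  induction s using Finset.induction with
  | empty => simpa using x.top_mem
  | insert i s hi ih => simp [inf_mem_iff, ih]

theorem sup_finset_mem_iff {ι : Type*} (s : Finset ι) (g : ι → A) (x : A.Point) :
    s.sup g ∈ x ↔ ∃ i ∈ s, g i ∈ x := by
  classical
  induction s using Finset.induction with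
  | empty => simpa using x.bot_notMem
  | insert i s hi ih => simp [sup_mem_iff, ih]

/-- A basic open set of the product constrains finitely many coordinates; the meet of the matching
elements or complements expresses this constraint as a single element. -/
theorem exists_basic_subset {U : Set A.Point} (hU : IsOpen U) {x : A.Point} (hx : x ∈ U) :
    ∃ a ∈ x, {y : A.Point | a ∈ y} ⊆ U := by
  classical
  obtain ⟨W, hW, rfl⟩ := isOpen_induced_iff.1 hU
  obtain ⟨s, u, hu, hsub⟩ := isOpen_pi_iff.1 hW x.1 hx
  have key : ∀ y : A.Point, s.inf (fun i => if i ∈ x then i else iᶜ) ∈ y ↔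
      ∀ i ∈ s, x.1 i = y.1 i := fun y => by
    rw [inf_finset_mem_iff]
    refine forall₂_congr fun i _ => ?_
    rw [Bool.eq_iff_iff]
    change _ ↔ (i ∈ x ↔ i ∈ y)
    split_ifs with h
    · simp [h]
    · simp [h, compl_mem_iff]
  refine ⟨_, (key x).2 fun _ _ => rfl, fun y hy => hsub fun i hi => ?_⟩
  rw [← (key y).1 hy i hi]
  exact (hu i hi).2

theorem isClopen_iff {U : Set A.Point} : IsClopen U ↔ ∃ a : A, U = {x | a ∈ x} := by
  constructor
  · intro hU
    choose a ha hsub using fun x : U => exists_basic_subset hU.isOpen x.2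
    obtain ⟨t, ht⟩ := hU.isClosed.isCompact.elim_finite_subcover
      -- By compactness finitely many basic sets cover `U`; the join of their elements represents
      -- it.
      (fun x : U => {y : A.Point | a x ∈ y}) (fun x => (isClopen_mem _).isOpen)
      (fun x hx => Set.mem_iUnion.2 ⟨⟨x, hx⟩, ha ⟨x, hx⟩⟩)
    refine ⟨t.sup a, Set.ext fun x => ?_⟩
    rw [Set.mem_ofPred_eq, sup_finset_mem_iff]
    constructor
    · intro hx; simpa using ht hx
    · rintro ⟨i, -, hi⟩; exact hsub i hi
  · rintro ⟨a, rfl⟩; exact isClopen_mem a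

end Point

/-- The dual modal space of a modal algebra. -/
def dual (A : ModalAlgebra) : ModalSpace where
  carrier := A.Point
  rel := Point.Rel
  isClosed_image x := by
    have : {y | Point.Rel x y} = ⋂ a, {y : A.Point | a ∈ y → A.dia a ∈ x} := by
      ext y; simp [Point.Rel]
    rw [this]
    refine isClosed_iInter fun a => ?_
    by_cases h : A.dia a ∈ x
    · simp [h]
    · have e : {y : A.Point | a ∈ y → A.dia a ∈ x} = {y : A.Point | a ∈ y}ᶜ := by
        ext y; simp [h]
      rw [e]; exact (Point.isClopen_mem a).compl.isClosed
  isClopen_preimage U hU := by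
    obtain ⟨a, rfl⟩ := Point.isClopen_iff.1 hU
    have : {x : A.Point | ∃ y ∈ {y : A.Point | a ∈ y}, Point.Rel x y} = {x | A.dia a ∈ x} := by
      ext x; simp [Point.dia_mem_iff, and_comm]
    rw [this]; exact Point.isClopen_mem _

instance (A : ModalAlgebra) : Membership A A.dual := inferInstanceAs (Membership A A.Point)

/-- The valuation on the dual space induced by a valuation on the algebra. -/
def dualVal (A : ModalAlgebra) (V : ℕ → A) : ℕ → Set A.dual := fun n => {x : A.Point | V n ∈ x}

theorem isClopen_dualVal (A : ModalAlgebra) (V : ℕ → A) (n : ℕ) : IsClopen (A.dualVal V n) :=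
  Point.isClopen_mem (V n)

/-- The truth lemma, with `dia_mem_iff` as its modal case. -/
theorem sat_dual (A : ModalAlgebra) (V : ℕ → A) (φ : Formula) (x : A.Point) :
    A.dual.Sat (A.dualVal V) x φ ↔ A.eval V φ ∈ x := by
  induction φ generalizing x with
  | var n => exact Iff.rfl
  | bot => exact ⟨False.elim, x.bot_notMem⟩
  | neg φ ih => exact (not_congr (ih x)).trans x.compl_mem_iff.symm
  | or φ ψ ih1 ih2 => exact (or_congr (ih1 x) (ih2 x)).trans x.sup_mem_iff.symm
  | dia φ ih =>
    exact (exists_congr fun y => and_congr_right fun _ => ih y).trans x.dia_mem_iff.symm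

theorem forall_sat_dual (A : ModalAlgebra) (V : ℕ → A) (φ : Formula) :
    (∀ x, A.dual.Sat (A.dualVal V) x φ) ↔ A.eval V φ = ⊤ := by
  rw [Point.eq_top_iff_forall_mem]
  exact forall_congr' fun x => A.sat_dual V φ x

theorem exists_eq_dualVal (A : ModalAlgebra) (U : ℕ → Set A.dual) (hU : ∀ n, IsClopen (U n)) :
    ∃ V : ℕ → A, U = A.dualVal V := by
  choose V hV using fun n => Point.isClopen_iff.1 (hU n)
  exact ⟨V, funext hV⟩

theorem validFormula_dual {A : ModalAlgebra} {φ : Formula} :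
    A.dual.ValidFormula φ ↔ A.ValidFormula φ := by
  constructor
  · intro h V
    exact (A.forall_sat_dual V φ).1 (h _ (A.isClopen_dualVal V))
  · intro h U hU
    obtain ⟨V, rfl⟩ := A.exists_eq_dualVal U hU
    exact (A.forall_sat_dual V φ).2 (h V)

theorem validRule_dual {A : ModalAlgebra} {ρ : Rule} : A.dual.ValidRule ρ ↔ A.ValidRule ρ := by
  constructor
  · intro h V
    simpa only [forall_sat_dual] using h _ (A.isClopen_dualVal V)
  · intro h U hU
    obtain ⟨V, rfl⟩ := A.exists_eq_dualVal U hU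
    simpa only [forall_sat_dual] using h V

theorem modelsLogic_dual {A : ModalAlgebra} {L : Set Formula} :
    A.dual.ModelsLogic L ↔ A.ModelsLogic L := forall₂_congr fun _ _ => validFormula_dual

theorem modelsSystem_dual {A : ModalAlgebra} {S : Set Rule} :
    A.dual.ModelsSystem S ↔ A.ModelsSystem S := forall₂_congr fun _ _ => validRule_dual

end ModalAlgebra

/-! ### Complex algebras of finite spaces -/

namespace ModalSpace

/-- The complex algebra of the underlying frame of a modal space. -/
def complexAlgebra (F : ModalSpace) : ModalAlgebra where
  carrier := Set F
  dia a := {x | ∃ y, F.rel x y ∧ y ∈ a}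
  dia_bot := by ext; simp
  dia_sup a b := by ext; simp [and_or_left, exists_or]

theorem mem_eval_complexAlgebra (F : ModalSpace) (V : ℕ → Set F) (φ : Formula) (x : F) :
    x ∈ (show Set F from F.complexAlgebra.eval V φ) ↔ F.Sat V x φ := by
  induction φ generalizing x with
  | var n => exact Iff.rfl
  | bot => exact Iff.rfl
  | neg φ ih => exact not_congr (ih x)
  | or φ ψ ih1 ih2 => exact or_congr (ih1 x) (ih2 x)
  | dia φ ih => exact exists_congr fun y => and_congr_right fun _ => ih y

theorem eval_complexAlgebra_eq_top (F : ModalSpace) (V : ℕ → Set F) (φ : Formula) :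
    F.complexAlgebra.eval V φ = ⊤ ↔ ∀ x, F.Sat V x φ := by
  exact Set.eq_univ_iff_forall.trans (forall_congr' (F.mem_eval_complexAlgebra V φ))

instance (F : ModalSpace) [Finite F] : Finite F.complexAlgebra :=
  inferInstanceAs (Finite (Set F))

/-- A finite Hausdorff space is discrete, so every valuation takes clopen values. -/
theorem validFormula_complexAlgebra {F : ModalSpace} [Finite F] {φ : Formula} :
    F.complexAlgebra.ValidFormula φ ↔ F.ValidFormula φ :=
  forall_congr' fun V => (F.eval_complexAlgebra_eq_top V φ).trans
    ⟨fun h _ => h, fun h => h fun _ => isClopen_discrete _⟩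

theorem validRule_complexAlgebra {F : ModalSpace} [Finite F] {ρ : Rule} :
    F.complexAlgebra.ValidRule ρ ↔ F.ValidRule ρ := by
  refine forall_congr' fun V => ?_
  have := F.eval_complexAlgebra_eq_top V
  rw [forall₂_congr fun γ _ => this γ, exists_congr fun δ => and_congr_right fun _ => this δ]
  exact ⟨fun h _ => h, fun h => h fun _ => isClopen_discrete _⟩

theorem modelsLogic_complexAlgebra {F : ModalSpace} [Finite F] {L : Set Formula} :
    F.complexAlgebra.ModelsLogic L ↔ F.ModelsLogic L :=
  forall₂_congr fun _ _ => validFormula_complexAlgebra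

theorem modelsSystem_complexAlgebra {F : ModalSpace} [Finite F] {S : Set Rule} :
    F.complexAlgebra.ModelsSystem S ↔ F.ModelsSystem S :=
  forall₂_congr fun _ _ => validRule_complexAlgebra

end ModalSpace


/-! ### The Subdivision Construction: factorization and satisfaction -/

namespace ModalSpace

theorem succ_le_rank_of_hasPath {X : ModalSpace} {n : ℕ} {x : X} (h : X.HasPath n x) :
    ((n + 1 : ℕ) : ℕ∞) ≤ X.rank x :=
  le_iSup₂ (f := fun (n : ℕ) (_ : X.HasPath n x) => ((n + 1 : ℕ) : ℕ∞)) n h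

/-- A path from `y` extends by the edge from `x` to a path with one more point. -/
theorem rank_le_of_rel {X : ModalSpace} {n : ℕ} {x y : X} (hxy : X.rel x y)
    (hx : X.rank x = (n + 1 : ℕ)) : X.rank y ≤ n := by
  refine iSup₂_le fun m hm => ?_
  have h := succ_le_rank_of_hasPath (X := X) (n := m + 1) (x := x) ⟨y, hxy, hm⟩
  rw [hx] at h
  exact_mod_cast Nat.le_of_succ_le_succ (Nat.cast_le.1 h)

end ModalSpace

namespace Stage

variable {X F : ModalSpace}

/-- The maps `X → F_n → F` of a stage are surjective, respectively relation-preserving, and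
compose to `f`. -/
structure Factors (T : Stage X F) (f : X → F) : Prop where
  map_rel : ∀ x y, X.rel x y → T.space.rel (T.map x) (T.map y)
  map_surjective : Function.Surjective T.map
  toBase_rel : ∀ p q, T.space.rel p q → F.rel (T.toBase p) (T.toBase q)
  toBase_map : ∀ x, T.toBase (T.map x) = f x

theorem stepBack_stepMap (T : Stage X F) (n : ℕ) (x : X) :
    T.stepBack n (T.stepMap n x) = T.map x := by
  unfold stepMap
  split_ifs <;> rfl

/-- The absence of arrows between fresh points does no harm: a successor of a point of rank `n + 1`
has rank at most `n`. From a fresh point to an old one, the arrow exists because `y` itself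
witnesses that `T.map y` is in the profile of `x`. -/
theorem stepRel_stepMap {T : Stage X F} {n : ℕ} {x y : X} (hxy : X.rel x y)
    (h : T.space.rel (T.map x) (T.map y)) :
    T.stepRel n (T.stepMap n x) (T.stepMap n y) := by
  unfold stepMap
  split_ifs with hx hy hy
  · have := ModalSpace.rank_le_of_rel h hx
    rw [hy] at this
    exact absurd (Nat.cast_le.1 this) (Nat.not_succ_le_self n)
  · exact ⟨⟨T.map y, ModalSpace.rank_le_of_rel h hx⟩, ⟨y, hxy, rfl⟩, rfl⟩
  · exact h
  · exact h

/-- The only new arrows lead from a fresh point `w^v_s` to a member of `s`. Since its piece is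
non-empty, `s` is the profile of an actual point over `v`, and the arrow is the image of one in `X`.
-/
theorem rel_stepBack {T : Stage X F} {n : ℕ}
    (hT : ∀ x y, X.rel x y → T.space.rel (T.map x) (T.map y)) {p q : T.Old n ⊕ T.New n}
    (h : T.stepRel n p q) : T.space.rel (T.stepBack n p) (T.stepBack n q) := by
  match p, q, h with
  | .inl p, .inl q, h => exact h
  | .inl p, .inr w, h => exact h
  | .inr ⟨⟨v, hv⟩, ⟨_, ⟨x, hx, rfl⟩⟩⟩, .inl q, ⟨c, ⟨y, hxy, hy⟩, hc⟩ =>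
    have := hT x y hxy
    rw [hx, hy, hc] at this
    exact this

theorem stepMap_surjective {T : Stage X F} {n : ℕ} (hT : Function.Surjective T.map) :
    Function.Surjective (T.stepMap n) := by
  rintro (⟨p, hp⟩ | ⟨⟨v, hv⟩, ⟨s, hs⟩⟩)
  · obtain ⟨x, rfl⟩ := hT p
    exact ⟨x, dif_neg hp⟩
  · obtain ⟨x, hx, hs'⟩ := id hs
    change T.map x = v at hx
    subst hx hs'
    exact ⟨x, dif_pos hv⟩

theorem Factors.step {T : Stage X F} {f : X → F} (h : T.Factors f) (n : ℕ) :
    (T.step n).Factors f where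
  map_rel x y hxy := stepRel_stepMap hxy (h.map_rel x y hxy)
  map_surjective := stepMap_surjective h.map_surjective
  toBase_rel _ _ hpq := h.toBase_rel _ _ (rel_stepBack h.map_rel hpq)
  toBase_map x := (congrArg T.toBase (T.stepBack_stepMap n x)).trans (h.toBase_map x)

/-- The closed domain condition for `f` makes `F_n` satisfy the same formulas as `X`. -/
theorem Factors.sat_iff {T : Stage X F} {f : X → F} (h : T.Factors f) {𝒟 : Set (Set F)}
    (hcdc : ModalSpace.CDC f 𝒟) {Θ : Set Formula} (hΘ : SubformulaClosed Θ)
    {U : ℕ → Set X} {W : ℕ → Set F} (hvar : ∀ n, Formula.var n ∈ Θ → U n = f ⁻¹' W n)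
    (hdia : ∀ φ : Formula, φ.dia ∈ Θ → ∃ D ∈ 𝒟, ∀ x, X.Sat U x φ ↔ f x ∈ D)
    {φ : Formula} (hφ : φ ∈ Θ) (x : X) :
    X.Sat U x φ ↔ T.space.Sat (fun n => T.toBase ⁻¹' W n) (T.map x) φ := by
  induction φ generalizing x with
  | var n =>
    change x ∈ U n ↔ T.toBase (T.map x) ∈ W n
    rw [hvar n hφ, h.toBase_map]; rfl
  | bot => exact Iff.rfl
  | neg φ ih => exact not_congr (ih (hΘ _ hφ _ rfl) x)
  | or φ ψ ih1 ih2 =>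
    exact or_congr (ih1 (hΘ _ hφ _ (Or.inl rfl)) x) (ih2 (hΘ _ hφ _ (Or.inr rfl)) x)
  | dia φ ih =>
    have ih := ih (hΘ _ hφ _ rfl)
    constructor
    · rintro ⟨y, hxy, hy⟩
      exact ⟨T.map y, h.map_rel x y hxy, (ih y).1 hy⟩
    · rintro ⟨q, hq, hsat⟩
      obtain ⟨z, rfl⟩ := h.map_surjective q
      -- The arrow in `F_n` need not lift along `T.map`, but its projection to `F` ends in `D`, so
      -- the closed domain condition gives some successor of `x` satisfying `φ`; it need not lie
      -- over `q`.
      obtain ⟨D, hD, hiff⟩ := hdia φ hφ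
      have hrel := h.toBase_rel _ _ hq
      rw [h.toBase_map, h.toBase_map] at hrel
      obtain ⟨y, hxy, hy⟩ := hcdc D hD x ⟨f z, (hiff z).1 ((ih z).2 hsat), hrel⟩
      exact ⟨y, hxy, (hiff y).2 hy⟩

theorem Factors.forall_sat_iff {T : Stage X F} {f : X → F} (h : T.Factors f) {𝒟 : Set (Set F)}
    (hcdc : ModalSpace.CDC f 𝒟) {Θ : Set Formula} (hΘ : SubformulaClosed Θ)
    {U : ℕ → Set X} {W : ℕ → Set F} (hvar : ∀ n, Formula.var n ∈ Θ → U n = f ⁻¹' W n)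
    (hdia : ∀ φ : Formula, φ.dia ∈ Θ → ∃ D ∈ 𝒟, ∀ x, X.Sat U x φ ↔ f x ∈ D)
    {φ : Formula} (hφ : φ ∈ Θ) :
    (∀ x, X.Sat U x φ) ↔ ∀ p, T.space.Sat (fun n => T.toBase ⁻¹' W n) p φ :=
  (forall_congr' (h.sat_iff hcdc hΘ hvar hdia hφ)).trans
    (h.map_surjective.forall (p := fun p => T.space.Sat (fun n => T.toBase ⁻¹' W n) p φ)).symm

end Stage

theorem stage_factors {X F : ModalSpace} [Finite F] {f : X → F}
    (hrel : ∀ x y, X.rel x y → F.rel (f x) (f y)) (hf : Function.Surjective f) (k : ℕ) :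
    (stage f k).Factors f := by
  induction k with
  | zero => exact ⟨hrel, hf, fun _ _ h => h, fun _ => rfl⟩
  | succ k ih => exact ih.step (k + 1)

theorem subdivision_factors {X F : ModalSpace} [Finite F] {f : X → F} {𝒟 : Set (Set F)}
    (h : ModalSpace.StableOnto 𝒟 f) : (subdivision f).Factors f :=
  stage_factors h.1.2 h.2.1 _


/-! ### The dual of a definable filtration -/

namespace DefinableFiltration

variable {A : ModalAlgebra} {V : ℕ → A} {Θ Θ' : Set Formula} (E : DefinableFiltration A V Θ Θ')

/-- The inclusion of a definable filtration into the filtrated algebra. -/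
def incl (b : E.algebra) : A := Subtype.val (p := (· ∈ filtrationCarrier A V Θ')) b

/-- The map dual to the inclusion of a definable filtration. -/
def dualMap (x : A.dual) : E.algebra.dual :=
  ⟨fun b => Subtype.val x (E.incl b),
    ModalAlgebra.Point.top_mem (A := A) x,
    fun a b => (Subtype.property x).2.1 (E.incl a) (E.incl b),
    fun a => (Subtype.property x).2.2 (E.incl a)⟩

theorem incl_le_iff {a b : E.algebra} : E.incl a ≤ E.incl b ↔ a ≤ b := Iff.rfl

theorem dualMap_continuous : Continuous E.dualMap :=
  Continuous.subtype_mk (continuous_pi fun b => ModalAlgebra.Point.continuous_apply (E.incl b)) _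

theorem dualMap_rel (x y : A.Point) (h : A.dual.rel x y) :
    E.algebra.dual.rel (E.dualMap x) (E.dualMap y) := fun b hb =>
  ModalAlgebra.Point.mem_of_le (x := x) (E.stable b) (h (E.incl b) hb)

/-- Ultrafilters extend from a subalgebra: the upward closure of `y` and the downward closure of its
complement are disjoint in `A`, and any point separating them restricts to `y`. -/
theorem dualMap_surjective : Function.Surjective E.dualMap := by
  intro (y : E.algebra.Point)
  have hF : Order.IsPFilter {a : A | ∃ b : E.algebra, b ∈ y ∧ E.incl b ≤ a} :=
    Order.IsPFilter.of_def ⟨⊤, ⊤, y.top_mem, le_top⟩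
      (fun a ⟨b, hb, hba⟩ a' ⟨b', hb', hba'⟩ => ⟨a ⊓ a', ⟨b ⊓ b', y.inf_mem_iff.2 ⟨hb, hb'⟩,
        inf_le_inf hba hba'⟩, inf_le_left, inf_le_right⟩)
      (fun h ⟨b, hb, hba⟩ => ⟨b, hb, hba.trans h⟩)
  have hI : Order.IsIdeal {a : A | ∃ b : E.algebra, b ∉ y ∧ a ≤ E.incl b} :=
    ⟨fun a a' h ⟨b, hb, hba⟩ => ⟨b, hb, h.trans hba⟩, ⟨⊥, ⊥, y.bot_notMem, bot_le⟩,
      fun a ⟨b, hb, hba⟩ a' ⟨b', hb', hba'⟩ => ⟨a ⊔ a', ⟨b ⊔ b',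
        fun h => (y.sup_mem_iff.1 h).elim hb hb', sup_le_sup hba hba'⟩, le_sup_left, le_sup_right⟩⟩
  obtain ⟨x, h1, h2⟩ := ModalAlgebra.Point.exists_separating hF hI (Set.disjoint_left.2
    fun a ⟨b, hb, hba⟩ ⟨b', hb', hab'⟩ => hb'
      (ModalAlgebra.Point.mem_of_le (E.incl_le_iff.1 (hba.trans hab')) hb))
  refine ⟨x, ModalAlgebra.Point.ext fun b => ?_⟩
  exact ⟨fun h => by_contra fun hb => h2 _ ⟨b, hb, le_rfl⟩ h, fun h => h1 _ ⟨b, h, le_rfl⟩⟩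

/-- The closed domain of the dual map: the clopen sets given by values of those formulas `φ` for
which `◇φ` belongs to `Θ`. -/
def closedDomain : Set (Set E.algebra.dual) :=
  {D | ∃ b : E.algebra, (∃ φ : Formula, φ.dia ∈ Θ ∧ E.incl b = A.eval V φ) ∧
    D = {y : E.algebra.Point | b ∈ y}}

/-- On the closed domain the two diamonds agree, so a successor of the image of `x` inside `D` puts
`◇b` into `x`, and `dia_mem_iff` supplies a successor in `A.dual`. -/
theorem dualMap_cdc : ModalSpace.CDC E.dualMap E.closedDomain := by
  rintro D ⟨b, hb, rfl⟩ (x : A.Point) ⟨(q : E.algebra.Point), hq, hxq⟩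
  have h : E.incl (E.algebra.dia b) ∈ x := hxq b hq
  have e : E.incl (E.algebra.dia b) = A.dia (E.incl b) := E.cdc b hb
  rw [e, x.dia_mem_iff] at h
  exact h

theorem dualMap_stableOnto : ModalSpace.StableOnto E.closedDomain E.dualMap :=
  ⟨⟨E.dualMap_continuous, E.dualMap_rel⟩, E.dualMap_surjective, E.dualMap_cdc⟩

/-- An ultrafilter is determined by its trace on a set of Boolean generators. -/
theorem point_ext {x y : E.algebra.Point}
    (h : ∀ b : E.algebra, (∃ φ ∈ Θ', A.eval V φ = E.incl b) → (b ∈ x ↔ b ∈ y)) : x = y := by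
  refine ModalAlgebra.Point.ext fun b => ?_
  obtain ⟨a, ha⟩ := b
  induction ha using BooleanSubalgebra.closure_bot_sup_induction with
  | mem a ha => exact h _ ha
  | bot => exact iff_of_false x.bot_notMem y.bot_notMem
  | sup a ha b hb iha ihb =>
    exact x.sup_mem_iff.trans ((or_congr iha ihb).trans y.sup_mem_iff.symm)
  | compl a ha iha =>
    exact x.compl_mem_iff.trans ((not_congr iha).trans y.compl_mem_iff.symm)

/-- A point is coded by the truth values it assigns to the formulas of `Θ'`. -/
theorem finite_dual (hΘ' : Θ'.Finite) : Finite E.algebra.dual := by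
  have : Finite Θ' := hΘ'
  let val (φ : Θ') : E.algebra :=
    ⟨A.eval V φ, BooleanSubalgebra.subset_closure ⟨φ, φ.2, rfl⟩⟩
  refine Finite.of_injective (β := Θ' → Bool) (fun (x : E.algebra.Point) φ => x.1 (val φ))
    fun x y hxy => E.point_ext ?_
  rintro b ⟨φ, hφ, hb⟩
  have e : val ⟨φ, hφ⟩ = b := Subtype.ext hb
  rw [← e]
  exact Bool.eq_iff_iff.1 (congrFun hxy ⟨φ, hφ⟩)

/-- The Subdivision Construction applied to the dual of a definable filtration satisfies the same
formulas of `Θ` as the original algebra. -/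
theorem eval_eq_top_iff [Finite E.algebra.dual] (hΘ : SubformulaClosed Θ) (hΘΘ' : Θ ⊆ Θ')
    {φ : Formula} (hφ : φ ∈ Θ) :
    A.eval V φ = ⊤ ↔ ∀ p, (subdivision E.dualMap).space.Sat
      (fun n => (subdivision E.dualMap).toBase ⁻¹' E.algebra.dualVal E.val n) p φ := by
  rw [← A.forall_sat_dual]
  refine (subdivision_factors E.dualMap_stableOnto).forall_sat_iff E.dualMap_cdc hΘ ?_ ?_ hφ
  · intro n hn
    ext x
    change V n ∈ x ↔ E.incl (E.val n) ∈ x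
    rw [show E.incl (E.val n) = V n from E.val_mem n (hΘΘ' hn)]
  · intro ψ hψ
    let b : E.algebra :=
      ⟨A.eval V ψ, BooleanSubalgebra.subset_closure ⟨ψ, hΘΘ' (hΘ _ hψ _ rfl), rfl⟩⟩
    exact ⟨_, ⟨b, ⟨ψ, hψ, rfl⟩, rfl⟩, fun x => A.sat_dual V ψ x⟩

end DefinableFiltration

/-! ### Finite subformula-closed sets -/

/-- The set of subformulas of a formula. -/
def Formula.subformulas : Formula → Set Formula
  | .var n => {.var n}
  | .bot => {.bot}
  | .neg φ => insert φ.neg φ.subformulas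
  | .or φ ψ => insert (φ.or ψ) (φ.subformulas ∪ ψ.subformulas)
  | .dia φ => insert φ.dia φ.subformulas

namespace Formula

theorem mem_subformulas_self (φ : Formula) : φ ∈ φ.subformulas := by
  cases φ <;> simp [subformulas]

theorem finite_subformulas (φ : Formula) : φ.subformulas.Finite := by
  induction φ with
  | var n => exact Set.finite_singleton _
  | bot => exact Set.finite_singleton _
  | neg φ ih => exact ih.insert _
  | or φ ψ ih1 ih2 => exact (ih1.union ih2).insert _
  | dia φ ih => exact ih.insert _

theorem subformulaClosed_subformulas (φ : Formula) : SubformulaClosed φ.subformulas := by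
  induction φ with
  | var n => rintro _ rfl ψ hψ; exact hψ.elim
  | bot => rintro _ rfl ψ hψ; exact hψ.elim
  | neg φ ih =>
    rintro χ (rfl | hχ) ψ hψ
    · obtain rfl : ψ = φ := hψ
      exact Or.inr ψ.mem_subformulas_self
    · exact Or.inr (ih χ hχ ψ hψ)
  | or φ φ' ih ih' =>
    rintro χ (rfl | hχ | hχ) ψ hψ
    · obtain rfl | rfl : ψ = φ ∨ ψ = φ' := hψ
      · exact Or.inr (Or.inl ψ.mem_subformulas_self)
      · exact Or.inr (Or.inr ψ.mem_subformulas_self)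
    · exact Or.inr (Or.inl (ih χ hχ ψ hψ))
    · exact Or.inr (Or.inr (ih' χ hχ ψ hψ))
  | dia φ ih =>
    rintro χ (rfl | hχ) ψ hψ
    · obtain rfl : ψ = φ := hψ
      exact Or.inr ψ.mem_subformulas_self
    · exact Or.inr (ih χ hχ ψ hψ)

end Formula

theorem exists_finite_subformulaClosed {Γ : Set Formula} (hΓ : Γ.Finite) :
    ∃ Θ : Set Formula, Γ ⊆ Θ ∧ Θ.Finite ∧ SubformulaClosed Θ := by
  refine ⟨⋃ φ ∈ Γ, φ.subformulas, fun φ hφ => Set.mem_biUnion hφ φ.mem_subformulas_self,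
    hΓ.biUnion fun φ _ => φ.finite_subformulas, fun χ hχ ψ hψ => ?_⟩
  obtain ⟨φ, hφ, hχ⟩ := Set.mem_iUnion₂.1 hχ
  exact Set.mem_biUnion hφ (φ.subformulaClosed_subformulas χ hχ ψ hψ)


/-! ### Theories and their Lindenbaum algebras -/

/-- Sets of formulas closed under the axioms and rules of the least normal modal logic, but not
necessarily under substitution. -/
structure IsTheory (T : Set Formula) : Prop where
  taut : ∀ φ : Formula, φ.Tautology → φ ∈ T
  axiomK : ∀ φ ψ : Formula, ((φ.imp ψ).box.imp (φ.box.imp ψ.box)) ∈ T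
  dual : ∀ φ : Formula, (φ.dia.iff φ.neg.box.neg) ∈ T
  mp : ∀ φ ψ : Formula, φ.imp ψ ∈ T → φ ∈ T → ψ ∈ T
  nec : ∀ φ : Formula, φ ∈ T → φ.box ∈ T

theorem IsLogic.isTheory {L : Set Formula} (h : IsLogic L) : IsTheory L :=
  ⟨h.taut, h.axiomK, h.dual, h.mp, h.nec⟩

namespace Formula

@[simp] theorem propEval_bot (v : Formula → Prop) : propEval v bot ↔ False := Iff.rfl
@[simp] theorem propEval_neg (v : Formula → Prop) (φ : Formula) :
    propEval v φ.neg ↔ ¬ propEval v φ := Iff.rfl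
@[simp] theorem propEval_or (v : Formula → Prop) (φ ψ : Formula) :
    propEval v (φ.or ψ) ↔ propEval v φ ∨ propEval v ψ := Iff.rfl
@[simp] theorem propEval_and (v : Formula → Prop) (φ ψ : Formula) :
    propEval v (φ.and ψ) ↔ propEval v φ ∧ propEval v ψ := by
  simp [and]
@[simp] theorem propEval_imp (v : Formula → Prop) (φ ψ : Formula) :
    propEval v (φ.imp ψ) ↔ (propEval v φ → propEval v ψ) := by
  simp only [imp, propEval_or, propEval_neg]; tauto
@[simp] theorem propEval_iff (v : Formula → Prop) (φ ψ : Formula) :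
    propEval v (φ.iff ψ) ↔ (propEval v φ ↔ propEval v ψ) := by
  simp only [iff, propEval_and, propEval_imp]; tauto

end Formula

namespace IsTheory

open Formula

variable {T : Set Formula}

theorem of_entails (hT : IsTheory T) {φ ψ : Formula} (h : ∀ v, propEval v φ → propEval v ψ)
    (hφ : φ ∈ T) : ψ ∈ T :=
  hT.mp φ ψ (hT.taut _ fun v => (propEval_imp v φ ψ).2 (h v)) hφ

theorem of_entails₂ (hT : IsTheory T) {φ ψ χ : Formula}
    (h : ∀ v, propEval v φ → propEval v ψ → propEval v χ)
    (hφ : φ ∈ T) (hψ : ψ ∈ T) : χ ∈ T :=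
  hT.mp ψ χ (hT.of_entails (fun v hv => (propEval_imp v ψ χ).2 (h v hv)) hφ) hψ

theorem of_entails₃ (hT : IsTheory T) {φ ψ χ θ : Formula}
    (h : ∀ v, propEval v φ → propEval v ψ → propEval v χ → propEval v θ)
    (hφ : φ ∈ T) (hψ : ψ ∈ T) (hχ : χ ∈ T) : θ ∈ T :=
  hT.mp χ θ (hT.of_entails₂ (fun v h1 h2 => (propEval_imp v χ θ).2 (h v h1 h2)) hφ hψ) hχ

theorem imp_refl (hT : IsTheory T) (φ : Formula) : φ.imp φ ∈ T := hT.taut _ fun v => by simp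

theorem imp_trans (hT : IsTheory T) {φ ψ χ : Formula} (h1 : φ.imp ψ ∈ T)
    (h2 : ψ.imp χ ∈ T) : φ.imp χ ∈ T :=
  hT.of_entails₂ (fun v => by simp only [propEval_imp]; tauto) h1 h2

theorem box_mono (hT : IsTheory T) {φ ψ : Formula} (h : φ.imp ψ ∈ T) : φ.box.imp ψ.box ∈ T :=
  hT.mp _ _ (hT.axiomK φ ψ) (hT.nec _ h)

theorem dia_mono (hT : IsTheory T) {φ ψ : Formula} (h : φ.imp ψ ∈ T) : φ.dia.imp ψ.dia ∈ T := by
  have h' : ψ.neg.box.imp φ.neg.box ∈ T :=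
    hT.box_mono (hT.of_entails (fun v => by simp only [propEval_imp, propEval_neg]; tauto) h)
  exact hT.of_entails₃
    (fun v => by simp only [propEval_imp, propEval_neg, propEval_iff]; tauto)
    h' (hT.dual φ) (hT.dual ψ)

theorem dia_bot (hT : IsTheory T) : bot.dia.imp bot ∈ T := by
  have h : bot.neg.box ∈ T := hT.nec _ (hT.taut _ fun v => by simp)
  exact hT.of_entails₂
    (fun v => by simp only [propEval_imp, propEval_neg, propEval_iff]; tauto) h (hT.dual bot)

theorem dia_or (hT : IsTheory T) (φ ψ : Formula) : (φ.or ψ).dia.imp (φ.dia.or ψ.dia) ∈ T := by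
  have h1 : φ.neg.box.imp (ψ.neg.imp (φ.or ψ).neg).box ∈ T :=
    hT.box_mono (hT.taut _ fun v => by
      simp only [propEval_imp, propEval_neg, propEval_or]; tauto)
  have h2 : φ.neg.box.imp (ψ.neg.box.imp (φ.or ψ).neg.box) ∈ T := hT.imp_trans h1 (hT.axiomK _ _)
  have h3 : φ.neg.box.imp (ψ.neg.box.imp (φ.or ψ).dia.neg) ∈ T :=
    hT.of_entails₂ (fun v => by simp only [propEval_imp, propEval_neg, propEval_iff]; tauto)
      h2 (hT.dual (φ.or ψ))
  exact hT.of_entails₃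
    (fun v => by simp only [propEval_imp, propEval_neg, propEval_iff, propEval_or]; tauto)
    h3 (hT.dual φ) (hT.dual ψ)

end IsTheory

/-- Provable equivalence in a theory. -/
def IsTheory.setoid {T : Set Formula} (hT : IsTheory T) : Setoid Formula where
  r φ ψ := φ.imp ψ ∈ T ∧ ψ.imp φ ∈ T
  iseqv := ⟨fun φ => ⟨hT.imp_refl φ, hT.imp_refl φ⟩, fun h => ⟨h.2, h.1⟩,
    fun h h' => ⟨hT.imp_trans h.1 h'.1, hT.imp_trans h'.2 h.2⟩⟩

/-- The underlying type of the Lindenbaum algebra of a theory. -/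
def Lindenbaum {T : Set Formula} (hT : IsTheory T) : Type := Quotient hT.setoid

namespace Lindenbaum

open Formula

variable {T : Set Formula} {hT : IsTheory T}

/-- The class of a formula. -/
def mk (φ : Formula) : Lindenbaum hT := Quotient.mk hT.setoid φ

theorem mk_surjective : Function.Surjective (mk : Formula → Lindenbaum hT) := Quotient.mk_surjective

theorem mk_eq_mk {φ ψ : Formula} :
    (mk φ : Lindenbaum hT) = mk ψ ↔ φ.imp ψ ∈ T ∧ ψ.imp φ ∈ T :=
  @Quotient.eq _ hT.setoid φ ψ

instance : LE (Lindenbaum hT) :=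
  ⟨Quotient.lift₂ (fun φ ψ => φ.imp ψ ∈ T) fun _ _ _ _ h h' => propext
    ⟨fun H => hT.imp_trans h.2 (hT.imp_trans H h'.1),
      fun H => hT.imp_trans h.1 (hT.imp_trans H h'.2)⟩⟩

theorem mk_le_mk {φ ψ : Formula} : (mk φ : Lindenbaum hT) ≤ mk ψ ↔ φ.imp ψ ∈ T := Iff.rfl

instance : Compl (Lindenbaum hT) :=
  ⟨Quotient.map' neg fun _ _ h =>
    ⟨hT.of_entails (fun v => by simp only [propEval_imp, propEval_neg]; tauto) h.2,
      hT.of_entails (fun v => by simp only [propEval_imp, propEval_neg]; tauto) h.1⟩⟩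

instance : Max (Lindenbaum hT) :=
  ⟨Quotient.map₂ or fun _ _ h _ _ h' =>
    ⟨hT.of_entails₂ (fun v => by simp only [propEval_imp, propEval_or]; tauto) h.1 h'.1,
      hT.of_entails₂ (fun v => by simp only [propEval_imp, propEval_or]; tauto) h.2 h'.2⟩⟩

instance : Min (Lindenbaum hT) :=
  ⟨Quotient.map₂ and fun _ _ h _ _ h' =>
    ⟨hT.of_entails₂ (fun v => by simp only [propEval_imp, propEval_and]; tauto) h.1 h'.1,
      hT.of_entails₂ (fun v => by simp only [propEval_imp, propEval_and]; tauto) h.2 h'.2⟩⟩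

instance : Bot (Lindenbaum hT) := ⟨mk bot⟩
instance : Top (Lindenbaum hT) := ⟨mk bot.neg⟩

theorem top_eq : (⊤ : Lindenbaum hT) = mk bot.neg := rfl

theorem mk_le_mk_of_entails {φ ψ : Formula} (h : ∀ v, propEval v φ → propEval v ψ) :
    (mk φ : Lindenbaum hT) ≤ mk ψ :=
  hT.taut _ fun v => (propEval_imp v φ ψ).2 (h v)

instance : BooleanAlgebra (Lindenbaum hT) where
  le_refl := mk_surjective.forall.2 fun φ => hT.imp_refl φ
  le_trans := mk_surjective.forall.2 fun φ => mk_surjective.forall.2 fun ψ =>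
    mk_surjective.forall.2 fun χ => hT.imp_trans
  le_antisymm := mk_surjective.forall₂.2 fun φ ψ h h' => mk_eq_mk.2 ⟨h, h'⟩
  sup := max
  inf := min
  le_sup_left := mk_surjective.forall₂.2 fun φ ψ => mk_le_mk_of_entails fun v h => Or.inl h
  le_sup_right := mk_surjective.forall₂.2 fun φ ψ => mk_le_mk_of_entails fun v h => Or.inr h
  sup_le := mk_surjective.forall₃.2 fun φ ψ χ h h' =>
    hT.of_entails₂ (fun v => by simp only [propEval_imp, propEval_or]; tauto) h h'
  inf_le_left := mk_surjective.forall₂.2 fun φ ψ =>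
    mk_le_mk_of_entails fun v h => ((propEval_and v φ ψ).1 h).1
  inf_le_right := mk_surjective.forall₂.2 fun φ ψ =>
    mk_le_mk_of_entails fun v h => ((propEval_and v φ ψ).1 h).2
  le_inf := mk_surjective.forall₃.2 fun φ ψ χ h h' =>
    hT.of_entails₂ (fun v => by simp only [propEval_imp, propEval_and]; tauto) h h'
  le_sup_inf := mk_surjective.forall₃.2 fun φ ψ χ =>
    mk_le_mk_of_entails fun v => by simp only [propEval_or, propEval_and]; tauto
  inf_compl_le_bot := mk_surjective.forall.2 fun φ =>
    mk_le_mk_of_entails fun v => by simp only [propEval_neg, propEval_and]; tauto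
  top_le_sup_compl := mk_surjective.forall.2 fun φ =>
    mk_le_mk_of_entails fun v => by simp only [propEval_neg, propEval_or]; tauto
  le_top := mk_surjective.forall.2 fun φ =>
    mk_le_mk_of_entails fun v => by simp
  bot_le := mk_surjective.forall.2 fun φ =>
    mk_le_mk_of_entails fun v => by simp

theorem mk_eq_top {φ : Formula} : (mk φ : Lindenbaum hT) = ⊤ ↔ φ ∈ T := by
  rw [← top_le_iff, top_eq, mk_le_mk]
  exact ⟨fun h => hT.mp _ _ h (hT.taut _ fun v => id),
    hT.of_entails fun v => by simp only [propEval_imp]; tauto⟩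

end Lindenbaum

/-- The Lindenbaum algebra of a theory. -/
def IsTheory.lindenbaum {T : Set Formula} (hT : IsTheory T) : ModalAlgebra where
  carrier := Lindenbaum hT
  dia := Quotient.map' Formula.dia fun _ _ h => ⟨hT.dia_mono h.1, hT.dia_mono h.2⟩
  dia_bot := Lindenbaum.mk_eq_mk.2
    ⟨hT.dia_bot, hT.taut _ fun v => by simp⟩
  dia_sup := Lindenbaum.mk_surjective.forall₂.2 fun φ ψ => Lindenbaum.mk_eq_mk.2
    ⟨hT.dia_or φ ψ, hT.of_entails₂
      (fun v => by simp only [Formula.propEval_imp, Formula.propEval_or]; tauto)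
      (hT.dia_mono (hT.taut (φ.imp (φ.or ψ)) fun v => by simp; tauto))
      (hT.dia_mono (hT.taut (ψ.imp (φ.or ψ)) fun v => by simp; tauto))⟩

theorem Formula.subst_var (φ : Formula) : φ.subst Formula.var = φ := by
  induction φ <;> simp_all [Formula.subst]

namespace IsTheory

variable {T : Set Formula} (hT : IsTheory T)

theorem eval_lindenbaum (s : ℕ → Formula) (φ : Formula) :
    hT.lindenbaum.eval (fun n => Lindenbaum.mk (s n)) φ =
      (Lindenbaum.mk (φ.subst s) : Lindenbaum hT) := by
  induction φ with
  | var n => rfl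
  | bot => rfl
  | neg φ ih => exact congrArg compl ih
  | or φ ψ ih1 ih2 => exact congrArg₂ max ih1 ih2
  | dia φ ih => exact congrArg hT.lindenbaum.dia ih

theorem eval_lindenbaum_eq_top (s : ℕ → Formula) (φ : Formula) :
    hT.lindenbaum.eval (fun n => Lindenbaum.mk (s n)) φ = ⊤ ↔ φ.subst s ∈ T := by
  rw [eval_lindenbaum]
  exact Lindenbaum.mk_eq_top

theorem eval_lindenbaum_var_eq_top (φ : Formula) :
    hT.lindenbaum.eval (fun n => Lindenbaum.mk (Formula.var n)) φ = ⊤ ↔ φ ∈ T := by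
  rw [eval_lindenbaum_eq_top, φ.subst_var]

theorem exists_eq_mk (V : ℕ → hT.lindenbaum) :
    ∃ s : ℕ → Formula, V = fun n => (Lindenbaum.mk (s n) : Lindenbaum hT) := by
  choose s hs using fun n => Lindenbaum.mk_surjective (hT := hT) (V n)
  exact ⟨s, funext fun n => (hs n).symm⟩

/-- Each valuation is induced by a substitution `s`, so closure of `L` under substitution suffices
even though `T` may lack it. -/
theorem lindenbaum_modelsLogic {L : Set Formula} (hL : IsLogic L) (h : L ⊆ T) :
    hT.lindenbaum.ModelsLogic L := by
  intro φ hφ V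
  obtain ⟨s, rfl⟩ := hT.exists_eq_mk V
  exact (hT.eval_lindenbaum_eq_top s φ).2 (h (hL.subst s φ hφ))

theorem lindenbaum_modelsSystem {S : Set Rule} (hS : IsRuleSystem S)
    (h : ∀ Γ Δ : Finset Formula, ⟨Γ, Δ⟩ ∈ S → (Γ : Set Formula) ⊆ T → ∃ δ ∈ Δ, δ ∈ T) :
    hT.lindenbaum.ModelsSystem S := by
  intro ρ hρ V hV
  obtain ⟨s, rfl⟩ := hT.exists_eq_mk V
  simp only [eval_lindenbaum_eq_top] at hV ⊢
  obtain ⟨_, hδ, hδT⟩ := h _ _ (hS.subst s ρ.prem ρ.concl hρ) (by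
    intro φ hφ
    obtain ⟨γ, hγ, rfl⟩ := Finset.mem_image.1 hφ
    exact hV γ hγ)
  obtain ⟨δ, hδ', rfl⟩ := Finset.mem_image.1 hδ
  exact ⟨δ, hδ', hδT⟩

end IsTheory

/-! ### Rule systems -/

theorem isTheory_logicK : IsTheory logicK where
  taut φ h _ hL := hL.taut φ h
  axiomK φ ψ _ hL := hL.axiomK φ ψ
  dual φ _ hL := hL.dual φ
  mp φ ψ h h' L hL := hL.mp φ ψ (h L hL) (h' L hL)
  nec φ h L hL := hL.nec φ (h L hL)

/-- A pair of sets of formulas is consistent if no rule of `S` leads from the first to the second;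
pairs are encoded as sets of signed formulas. -/
def Consistent (S : Set Rule) (P : Set (Formula × Bool)) : Prop :=
  ∀ Γ Δ : Finset Formula, (∀ γ ∈ Γ, (γ, true) ∈ P) → (∀ δ ∈ Δ, (δ, false) ∈ P) → ⟨Γ, Δ⟩ ∉ S

theorem exists_maximal_consistent {S : Set Rule}
    {P : Set (Formula × Bool)} (hP : Consistent S P) :
    ∃ M, P ⊆ M ∧ Maximal (Consistent S) M := by
  refine zorn_subset_nonempty {P | Consistent S P} ?_ P hP
  intro c hc hchain hne
  refine ⟨⋃₀ c, ?_, fun s hs => Set.subset_sUnion_of_mem hs⟩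
  intro Γ Δ hΓ hΔ
  have hfin : ((Γ.image (·, true) ∪ Δ.image (·, false) : Finset (Formula × Bool)) :
      Set (Formula × Bool)) ⊆ ⋃₀ c := by
    intro p hp
    simp only [Finset.coe_union, Finset.coe_image, Set.mem_union, Set.mem_image] at hp
    obtain ⟨γ, hγ, rfl⟩ | ⟨δ, hδ, rfl⟩ := hp
    · exact hΓ γ hγ
    · exact hΔ δ hδ
  -- Rules are finite, so an inconsistency of the union already occurs in one member of the chain.
  obtain ⟨s, hs, hsub⟩ := hchain.directedOn.exists_mem_subset_of_finset_subset_biUnion hne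
    (f := id)
    (hfin.trans Set.sUnion_eq_biUnion.subset)
  refine hc hs Γ Δ (fun γ hγ => hsub ?_) (fun δ hδ => hsub ?_)
  · simp [hγ]
  · simp [hδ]

namespace IsRuleSystem

variable {S : Set Rule}

theorem mono {Γ Δ Γ' Δ' : Finset Formula} (hS : IsRuleSystem S) (h : ⟨Γ, Δ⟩ ∈ S) (hΓ : Γ ⊆ Γ')
    (hΔ : Δ ⊆ Δ') : ⟨Γ', Δ'⟩ ∈ S := by
  have := hS.weakening Γ Δ Γ' Δ' h
  rwa [Finset.union_eq_right.2 hΓ, Finset.union_eq_right.2 hΔ] at this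

/-- If neither sign of `φ` could be added, there would be one rule in `S` using `φ` as a premise and
one using it as a conclusion; a cut on `φ` would make `M` inconsistent. -/
theorem mem_or_mem_of_maximal (hS : IsRuleSystem S) {M : Set (Formula × Bool)}
    (hM : Maximal (Consistent S) M) (φ : Formula) : (φ, true) ∈ M ∨ (φ, false) ∈ M := by
  by_contra! hφ
  have key : ∀ b, ¬ Consistent S (insert (φ, b) M) := fun b h =>
    (by cases b; exacts [hφ.2, hφ.1] : (φ, b) ∉ M)
      (hM.2 h (Set.subset_insert _ _) (Set.mem_insert _ _))
  have h1 := key true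
  have h2 := key false
  simp only [Consistent, not_forall, not_not] at h1 h2
  obtain ⟨Γ₁, Δ₁, hΓ₁, hΔ₁, h1⟩ := h1
  obtain ⟨Γ₂, Δ₂, hΓ₂, hΔ₂, h2⟩ := h2
  refine hM.1 (Γ₁.erase φ ∪ Γ₂) (Δ₁ ∪ Δ₂.erase φ) ?_ ?_ (hS.cut _ _ φ (hS.mono h2 ?_ ?_)
    (hS.mono h1 ?_ ?_))
  · intro γ hγ
    obtain hγ | hγ := Finset.mem_union.1 hγ
    · obtain ⟨hne, hγ⟩ := Finset.mem_erase.1 hγ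
      simpa [hne] using hΓ₁ γ hγ
    · simpa using hΓ₂ γ hγ
  · intro δ hδ
    obtain hδ | hδ := Finset.mem_union.1 hδ
    · simpa using hΔ₁ δ hδ
    · obtain ⟨hne, hδ⟩ := Finset.mem_erase.1 hδ
      simpa [hne] using hΔ₂ δ hδ
  · exact Finset.subset_union_right
  · intro δ hδ
    by_cases h : δ = φ <;> simp [h, hδ]
  · intro γ hγ
    by_cases h : γ = φ <;> simp [h, hγ]
  · exact Finset.subset_union_left

/-- A rule outside a rule system is refuted by a theory closed under the rule system. -/
theorem exists_theory (hS : IsRuleSystem S) {ρ : Rule} (hρ : ρ ∉ S) :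
    ∃ T : Set Formula, IsTheory T ∧
      (∀ Γ Δ : Finset Formula, ⟨Γ, Δ⟩ ∈ S → (Γ : Set Formula) ⊆ T → ∃ δ ∈ Δ, δ ∈ T) ∧
      (ρ.prem : Set Formula) ⊆ T ∧ ∀ δ ∈ ρ.concl, δ ∉ T := by
  obtain ⟨M, hPM, hM⟩ := exists_maximal_consistent (S := S)
    (P := {p | (p.2 = true ∧ p.1 ∈ ρ.prem) ∨ (p.2 = false ∧ p.1 ∈ ρ.concl)})
    (fun Γ Δ hΓ hΔ h => hρ (hS.mono h (fun γ hγ => by simpa using hΓ γ hγ)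
      (fun δ hδ => by simpa using hΔ δ hδ)))
  have hclosed : ∀ Γ Δ : Finset Formula, ⟨Γ, Δ⟩ ∈ S → (Γ : Set Formula) ⊆ {φ | (φ, true) ∈ M} →
      ∃ δ ∈ Δ, (δ, true) ∈ M := by
    intro Γ Δ h hΓ
    by_contra! hΔ
    exact hM.1 Γ Δ (fun γ hγ => hΓ hγ)
      (fun δ hδ => (hS.mem_or_mem_of_maximal hM δ).resolve_left (hΔ δ hδ)) h
  have hthm : ∀ φ ∈ logicK, (φ, true) ∈ M := fun φ hφ => by
    simpa using hclosed _ _ (hS.thm φ hφ) (by simp)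
  refine ⟨{φ | (φ, true) ∈ M}, ⟨?_, ?_, ?_, ?_, ?_⟩, hclosed,
    fun γ hγ => hPM (Or.inl ⟨rfl, hγ⟩), fun δ hδ hδM => ?_⟩
  · exact fun φ h => hthm _ (isTheory_logicK.taut φ h)
  · exact fun φ ψ => hthm _ (isTheory_logicK.axiomK φ ψ)
  · exact fun φ => hthm _ (isTheory_logicK.dual φ)
  · intro φ ψ h h'
    simpa using hclosed _ _ (hS.mp φ ψ) (by
      intro χ hχ
      simp only [Finset.coe_insert, Finset.coe_singleton, Set.mem_insert_iff,
        Set.mem_singleton_iff] at hχ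
      obtain rfl | rfl := hχ
      exacts [h', h])
  · intro φ h
    simpa using hclosed _ _ (hS.nec φ) (by simpa using h)
  -- A conclusion of `ρ` carries the sign `false` in `M`; with the sign `true` as well, `δ / δ`
  -- would contradict consistency.
  · exact hM.1 {δ} {δ} (by simpa using hδM) (by simpa using hPM (Or.inr ⟨rfl, hδ⟩)) (hS.refl δ)

end IsRuleSystem

/-! ### Logics -/

theorem IsTheory.exists_maximal {L : Set Formula} (hL : IsTheory L) {φ : Formula} (hφ : φ ∉ L) :
    ∃ T, L ⊆ T ∧ Maximal (fun T => IsTheory T ∧ φ ∉ T) T := by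
  refine zorn_subset_nonempty {T | IsTheory T ∧ φ ∉ T} ?_ L ⟨hL, hφ⟩
  intro c hc hchain ⟨T₀, hT₀⟩
  refine ⟨⋃₀ c, ⟨⟨?_, ?_, ?_, ?_, ?_⟩, ?_⟩, fun s hs => Set.subset_sUnion_of_mem hs⟩
  · exact fun ψ h => ⟨T₀, hT₀, (hc hT₀).1.taut ψ h⟩
  · exact fun ψ χ => ⟨T₀, hT₀, (hc hT₀).1.axiomK ψ χ⟩
  · exact fun ψ => ⟨T₀, hT₀, (hc hT₀).1.dual ψ⟩
  · rintro ψ χ ⟨T₁, h₁, h⟩ ⟨T₂, h₂, h'⟩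
    obtain h12 | h21 := hchain.total h₁ h₂
    · exact ⟨T₂, h₂, (hc h₂).1.mp ψ χ (h12 h) h'⟩
    · exact ⟨T₁, h₁, (hc h₁).1.mp ψ χ h (h21 h')⟩
  · rintro ψ ⟨T₁, h₁, h⟩
    exact ⟨T₁, h₁, (hc h₁).1.nec ψ h⟩
  · rintro ⟨T₁, h₁, h⟩
    exact (hc h₁).2 h

namespace ModalSpace

/-- The formulas true throughout an upset of a modal space form a theory. -/
theorem isTheory_setOf_sat (X : ModalSpace) (U : ℕ → Set X) {Y : Set X}
    (hY : ∀ x ∈ Y, ∀ y, X.rel x y → y ∈ Y) : IsTheory {φ | ∀ x ∈ Y, X.Sat U x φ} := by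
  have hprop : ∀ x φ, X.Sat U x φ ↔ φ.propEval (fun ψ => X.Sat U x ψ) := fun x φ => by
    induction φ with
    | var n => exact Iff.rfl
    | bot => exact Iff.rfl
    | neg φ ih => exact not_congr ih
    | or φ ψ ih1 ih2 => exact or_congr ih1 ih2
    | dia φ ih => exact Iff.rfl
  have himp : ∀ x φ ψ, X.Sat U x (φ.imp ψ) ↔ (X.Sat U x φ → X.Sat U x ψ) := fun x φ ψ => by
    rw [hprop, Formula.propEval_imp, ← hprop, ← hprop]
  have hneg : ∀ x φ, X.Sat U x φ.neg ↔ ¬ X.Sat U x φ := fun x φ => Iff.rfl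
  have hbox : ∀ x φ, X.Sat U x φ.box ↔ ∀ y, X.rel x y → X.Sat U y φ := fun x φ => by
    change (¬ ∃ y, X.rel x y ∧ ¬ X.Sat U y φ) ↔ _
    push Not
    rfl
  refine ⟨?_, ?_, ?_, ?_, ?_⟩
  · exact fun φ h x _ => (hprop x φ).2 (h _)
  · intro φ ψ x _
    simp only [himp, hbox]
    exact fun h h' y hxy => h y hxy (h' y hxy)
  · intro φ x _
    rw [hprop, Formula.propEval_iff, ← hprop, ← hprop, hneg, hbox]
    simp only [hneg, not_forall, not_not]
    exact exists_congr fun y => exists_prop.symm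
  · exact fun φ ψ h h' x hx => (himp x φ ψ).1 (h x hx) (h' x hx)
  -- Only necessitation needs `Y` to be closed under successors.
  · exact fun φ h x hx => (hbox x φ).2 fun y hxy => h y (hY x hx y hxy)

end ModalSpace

/-- The dual of the Lindenbaum algebra of a theory that is maximal without `φ` is topo-rooted. -/
theorem IsTheory.topoRooted_dual_lindenbaum {T : Set Formula} (hT : IsTheory T) {φ : Formula}
    (hmax : Maximal (fun T => IsTheory T ∧ φ ∉ T) T) : hT.lindenbaum.dual.TopoRooted := by
  let V : ℕ → hT.lindenbaum := fun n => (Lindenbaum.mk (Formula.var n) : Lindenbaum hT)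
  have hsat : ∀ (x : hT.lindenbaum.dual) ψ,
      hT.lindenbaum.dual.Sat (hT.lindenbaum.dualVal V) x ψ ↔ hT.lindenbaum.eval V ψ ∈ x :=
    fun x ψ => hT.lindenbaum.sat_dual V ψ x
  have hroot : ∀ x : hT.lindenbaum.dual, hT.lindenbaum.eval V φ ∉ x →
      hT.lindenbaum.dual.IsTopoRoot x := by
    intro x hx
    set Y := {y | Relation.ReflTransGen hT.lindenbaum.dual.rel x y} with hYdef
    -- `T'` is the theory of the part generated by `x`; it contains `T` and omits `φ`, so maximality
    -- forces `T' ⊆ T`. If that part missed a basic open set `[ψ]`, then `¬ψ` would lie in `T'`,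
    -- hence in `T`, and `[ψ]` would be empty.
    let T' := {ψ | ∀ y ∈ Y, hT.lindenbaum.dual.Sat (hT.lindenbaum.dualVal V) y ψ}
    have hT' : IsTheory T' := ModalSpace.isTheory_setOf_sat _ _ fun y hy z hyz => hy.tail hyz
    have hφ : φ ∉ T' := fun h => hx ((hsat x φ).1 (h x .refl))
    have hTT' : T ⊆ T' := fun ψ hψ y _ => by
      rw [hsat, (hT.eval_lindenbaum_var_eq_top ψ).2 hψ]
      exact ModalAlgebra.Point.top_mem (A := hT.lindenbaum) y
    refine Set.eq_univ_of_forall fun z => mem_closure_iff.2 fun O hO hzO => ?_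
    obtain ⟨b, hb, hbO⟩ := ModalAlgebra.Point.exists_basic_subset hO hzO
    obtain ⟨ψ, hψ⟩ := Lindenbaum.mk_surjective (hT := hT) b
    have hev : hT.lindenbaum.eval V ψ = b := by
      rw [← hψ, hT.eval_lindenbaum Formula.var, ψ.subst_var]
    by_contra hempty
    have hmem : ψ.neg ∈ T' := fun y hy h => by
      rw [hsat, hev] at h
      exact hempty ⟨y, hbO h, hy⟩
    have htop := (hT.eval_lindenbaum_var_eq_top ψ.neg).2 (hmax.2 ⟨hT', hφ⟩ hTT' hmem)
    have := ModalAlgebra.Point.eq_top_iff_forall_mem.1 htop z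
    exact (ModalAlgebra.Point.compl_mem_iff (A := hT.lindenbaum) z).1 this (hev ▸ hb)
  have hne : hT.lindenbaum.eval V φ ≠ ⊤ := fun h =>
    hmax.1.2 ((hT.eval_lindenbaum_var_eq_top φ).1 h)
  rw [Ne, ModalAlgebra.Point.eq_top_iff_forall_mem, not_forall] at hne
  obtain ⟨x, hx⟩ := hne
  exact ⟨x, mem_interior.2 ⟨_, hroot,
    (ModalAlgebra.Point.isClopen_mem (hT.lindenbaum.eval V φ)).compl.isOpen, hx⟩⟩

end ModalLogic
theorem theorem4 :
    (∀ S S' : Set ModalLogic.Rule,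
      ModalLogic.IsRuleSystem S → ModalLogic.IsRuleSystem S' → S ⊆ S' →
      ModalLogic.SystemAdmitsFiltration S → ModalLogic.PreservesSystem S S' →
      ModalLogic.SystemFMP S') ∧
    (∀ L L' : Set ModalLogic.Formula,
      ModalLogic.IsLogic L → ModalLogic.IsLogic L' → L ⊆ L' →
      ModalLogic.LogicAdmitsFiltration L → ModalLogic.PreservesLogic L L' →
      ModalLogic.LogicFMP L') := by
  open ModalLogic in
  constructor
  · intro S S' _ hS' hSS' hfilt hpres ρ hρ
    obtain ⟨T, hT, hclosed, hprem, hconcl⟩ := hS'.exists_theory hρ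
    obtain ⟨Θ, hρΘ, hΘfin, hΘ⟩ :=
      exists_finite_subformulaClosed (ρ.prem ∪ ρ.concl).finite_toSet
    obtain ⟨Θ', hΘ'fin, -, hΘΘ', h⟩ := hfilt Θ hΘfin hΘ
    have hA := hT.lindenbaum_modelsSystem hS' hclosed
    obtain ⟨E, hE⟩ := h hT.lindenbaum (fun σ hσ => hA σ (hSS' hσ))
      (fun n => (Lindenbaum.mk (Formula.var n) : Lindenbaum hT))
    have := E.finite_dual hΘ'fin
    have hF' := hpres hT.lindenbaum.dual E.algebra.dual E.closedDomain E.dualMap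
      E.dualMap_stableOnto (ModalAlgebra.modelsSystem_dual.2 hA)
      (ModalAlgebra.modelsSystem_dual.2 hE)
    refine ⟨_, inferInstance, ModalSpace.modelsSystem_complexAlgebra.2 hF', fun hval => ?_⟩
    -- The refuting valuation is that of the filtration, pulled back from `F` along the
    -- subdivision's map to `F`.
    obtain ⟨δ, hδ, hsat⟩ := ModalSpace.validRule_complexAlgebra.1 hval _
      (fun n => isClopen_discrete _) fun γ hγ =>
        (E.eval_eq_top_iff hΘ hΘΘ' (hρΘ (by simp [hγ]))).1
          ((hT.eval_lindenbaum_var_eq_top γ).2 (hprem hγ))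
    exact hconcl δ hδ ((hT.eval_lindenbaum_var_eq_top δ).1
      ((E.eval_eq_top_iff hΘ hΘΘ' (hρΘ (by simp [hδ]))).2 hsat))
  · intro L L' _ hL' hLL' hfilt hpres φ hφ
    obtain ⟨T, hLT, hmax⟩ := hL'.isTheory.exists_maximal hφ
    have hT := hmax.1.1
    obtain ⟨Θ', hΘ'fin, -, hΘΘ', h⟩ :=
      hfilt φ.subformulas φ.finite_subformulas φ.subformulaClosed_subformulas
    have hA := hT.lindenbaum_modelsLogic hL' hLT
    obtain ⟨E, hE⟩ := h hT.lindenbaum (fun ψ hψ => hA ψ (hLL' hψ))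
      (fun n => (Lindenbaum.mk (Formula.var n) : Lindenbaum hT))
    have := E.finite_dual hΘ'fin
    have hF' := hpres hT.lindenbaum.dual E.algebra.dual E.closedDomain E.dualMap
      E.dualMap_stableOnto (hT.topoRooted_dual_lindenbaum hmax)
      (ModalAlgebra.modelsLogic_dual.2 hA) (ModalAlgebra.modelsLogic_dual.2 hE)
    refine ⟨_, inferInstance, ModalSpace.modelsLogic_complexAlgebra.2 hF', fun hval => ?_⟩
    exact hmax.1.2 ((hT.eval_lindenbaum_var_eq_top φ).1
      ((E.eval_eq_top_iff φ.subformulaClosed_subformulas hΘΘ' φ.mem_subformulas_self).2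
        (ModalSpace.validFormula_complexAlgebra.1 hval _ fun n => isClopen_discrete _)))
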